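/- Let $\Gamma$ be an abelian group (for instance $\mathbb Z$, $\mathbb R$ or $\mathbb Z/n\mathbb Z$), and let $H_1(X)=H_1(X;\Gamma)$ denote first singular homology with coefficients in $\Gamma$. An *area extension* of a metric space $X$ is a metric space $X'$ together with an isometric embedding $\iota\colon X\to X'$ such that every connected component of $X'\setminus\iota(X)$ is homeomorphic to the open disc $\{x\in\mathbb R^2: |x|<1\}$ or to the open annulus $\{x\in\mathbb R^2: 1<|x|<2\}$. Its *excess area* is the (possibly infinite) sum, over all components of $X'\setminus\iota(X)$, of their 2-dimensional Hausdorff measures, where $$\mathcal H^2(A)=\lim_{\delta\to0}\inf\Big\{\sum_i \operatorname{diam}(U_i)^2 : A\subseteq\bigcup_i U_i,\ \operatorname{diam}(U_i)<\delta\Big\},$$ the infimum being over countable covers. For $a,b\in H_1(X)$ let $d_1(a,b)\in[0,\infty]$ be the infimum of the excess areas of all area extensions $(X',\iota)$ of $X$ with $\iota_*a=\iota_*b$ in $H_1(X')$ ($\infty$ if there are none). For a nonempty complete metric space $X$, $d_1$ is a translation-invariant extended pseudo-metric on $H_1(X)$; let $H_d(X)$ be the quotient group of $H_1(X)$ obtained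 by identifying classes at $d_1$-distance $0$, and let $\hat H_d(X)$ be the completion of $H_d(X)$ with respect to $d_1$, with the group operation extended by continuity. **Theorem.** Let $S^1$ be the unit circle in $\mathbb C$ with the metric $d(x,y)=|x-y|$. 1. The canonical map $H_1(S^1)\to\hat H_d(S^1)$ is an isomorphism of groups; in particular $\hat H_d(S^1)\cong H_1(S^1)$. 2. Let $\sigma$ be the singular 1-simplex traversing $S^1$ once, $(1-t,t)\mapsto e^{2\pi i t}$, and let $0\neq g\in\Gamma$. If $(X',\iota)$ is an area extension of $S^1$ in which the 1-cycle $g\cdot(\iota\circ\sigma)$ is null-homologous (is the boundary of a singular 2-chain with coefficients in $\Gamma$), then the excess area of $(X',\iota)$ is at least $1$. -/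

import Mathlib

open Set CategoryTheory AlgebraicTopology MeasureTheory
open scoped ENNReal Simplicial Topology

universe u

noncomputable section

/-! ### Area extensions -/

/-- The open unit disc of the Euclidean plane. -/
def openDisc : Set (EuclideanSpace ℝ (Fin 2)) := {x | ‖x‖ < 1}

/-- The open annulus `1 < |x| < 2` of the Euclidean plane. -/
def openCylinder : Set (EuclideanSpace ℝ (Fin 2)) := {x | 1 < ‖x‖ ∧ ‖x‖ < 2}

/-- An area extension of a metric space `X`: a metric space `carrier` with an isometric embedding
`incl : X → carrier` such that each connected component of `carrier \ incl(X)` is homeomorphic to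
the open disc or to the open cylinder. -/
structure AreaExtension (X : Type u) [MetricSpace X] where
  carrier : Type u
  [metric : MetricSpace carrier]
  incl : X → carrier
  isometry_incl : Isometry incl
  disc_or_cylinder : ∀ x ∈ (range incl)ᶜ,
    Nonempty (connectedComponentIn (range incl)ᶜ x ≃ₜ openDisc) ∨
    Nonempty (connectedComponentIn (range incl)ᶜ x ≃ₜ openCylinder)

/-- Two-dimensional Hausdorff measure of a subset of a metric space, built from the sums
`∑ diam(Uᵢ)²` over countable covers (no normalising factor). -/
def area {Y : Type u} [MetricSpace Y] (A : Set Y) : ℝ≥0∞ :=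
  letI : MeasurableSpace Y := borel Y
  haveI : BorelSpace Y := ⟨rfl⟩
  Measure.hausdorffMeasure 2 A

namespace AreaExtension

attribute [instance] AreaExtension.metric

variable {X : Type u} [MetricSpace X]

/-- The set of connected components of the complement of `X` in an area extension. -/
def components (E : AreaExtension X) : Set (Set E.carrier) :=
  {C | ∃ x ∈ (range E.incl)ᶜ, connectedComponentIn (range E.incl)ᶜ x = C}

/-- The excess area: the sum of the areas of all components of the complement of `X`. -/
def excess (E : AreaExtension X) : ℝ≥0∞ := ∑' C : E.components, area (C : Set E.carrier)

/-- The inclusion of `X` into an area extension as a continuous map. -/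
def inclC (E : AreaExtension X) : C(X, E.carrier) := ⟨E.incl, E.isometry_incl.continuous⟩

/-- The inclusion of `X` into an area extension as a morphism of topological spaces. -/
def hom (E : AreaExtension X) : TopCat.of X ⟶ TopCat.of E.carrier := TopCat.ofHom E.inclC

end AreaExtension

/-! ### First singular homology -/

/-- The first singular homology group `H₁(X; Γ)`. -/
def H1 (Γ : Type u) [AddCommGroup Γ] (X : Type u) [TopologicalSpace X] : Type u :=
  ((singularHomologyFunctor AddCommGrpCat.{u} 1).obj (AddCommGrpCat.of Γ)).obj (TopCat.of X)

instance (Γ : Type u) [AddCommGroup Γ] (X : Type u) [TopologicalSpace X] :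
    AddCommGroup (H1 Γ X) :=
  inferInstanceAs (AddCommGroup
    (((singularHomologyFunctor AddCommGrpCat.{u} 1).obj (AddCommGrpCat.of Γ)).obj (TopCat.of X)))

/-- The homomorphism induced on `H₁` by a continuous map. -/
def H1map (Γ : Type u) [AddCommGroup Γ] {X Y : Type u} [TopologicalSpace X] [TopologicalSpace Y]
    (f : TopCat.of X ⟶ TopCat.of Y) : H1 Γ X →+ H1 Γ Y :=
  (((singularHomologyFunctor AddCommGrpCat.{u} 1).obj (AddCommGrpCat.of Γ)).map f).hom

/-- The singular chain complex of `X` with coefficients in `Γ`. -/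
abbrev singularChains (Γ : Type u) [AddCommGroup Γ] (X : Type u) [TopologicalSpace X] :
    ChainComplex AddCommGrpCat.{u} ℕ :=
  ((singularChainComplexFunctor AddCommGrpCat.{u}).obj (AddCommGrpCat.of Γ)).obj (TopCat.of X)

/-- The elementary singular 1-chain `g · σ`, for a singular 1-simplex `σ` and `g ∈ Γ`. -/
def elemChain {Γ : Type u} [AddCommGroup Γ] {X : Type u} [TopologicalSpace X] (g : Γ)
    (σ : C(stdSimplex ℝ (Fin 2), X)) : (singularChains Γ X).X 1 :=
  ConcreteCategory.hom (C := AddCommGrpCat.{u}) (SSet.ιChainComplex (R := AddCommGrpCat.of Γ)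
    (TopCat.toSSet.obj (TopCat.of X))
    ((TopCat.toSSetObjEquiv (TopCat.of X) (Opposite.op ⦋1⦌)).symm σ)) g

/-- A singular 1-chain is null-homologous if it is the boundary of a singular 2-chain. -/
def IsNullHomologous {Γ : Type u} [AddCommGroup Γ] {X : Type u} [TopologicalSpace X]
    (c : (singularChains Γ X).X 1) : Prop :=
  ∃ b : (singularChains Γ X).X 2, (singularChains Γ X).d 2 1 b = c

/-! ### The pseudo-metric on `H₁` -/

/-- The distance `d₁(a, b)` of two classes: the infimum (`∞` if there are none) of the excess areas
of all area extensions of `X` in which `a` and `b` become the same homology class. -/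
def d₁ {Γ : Type u} [AddCommGroup Γ] {X : Type u} [MetricSpace X] (a b : H1 Γ X) : ℝ≥0∞ :=
  ⨅ (E : AreaExtension X) (_ : H1map Γ E.hom a = H1map Γ E.hom b), E.excess

section Helpers

theorem H1map_comp (Γ : Type u) [AddCommGroup Γ] {X Y Z : Type u} [TopologicalSpace X]
    [TopologicalSpace Y] [TopologicalSpace Z] (f : TopCat.of X ⟶ TopCat.of Y)
    (g : TopCat.of Y ⟶ TopCat.of Z) (a : H1 Γ X) :
    H1map Γ (f ≫ g) a = H1map Γ g (H1map Γ f a) := by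
  simp only [H1map, Functor.map_comp]
  rfl

theorem area_image {Y Z : Type u} [MetricSpace Y] [MetricSpace Z] {f : Y → Z} (hf : Isometry f)
    (A : Set Y) : area (f '' A) = area A := by
  let _ : MeasurableSpace Y := borel Y
  have _ : BorelSpace Y := ⟨rfl⟩
  let _ : MeasurableSpace Z := borel Z
  have _ : BorelSpace Z := ⟨rfl⟩
  exact hf.hausdorffMeasure_image (Or.inl (by norm_num)) A

namespace AreaExtension

variable {X : Type u} [MetricSpace X]

/-- The trivial area extension `X` of `X`. -/
def trivial (X : Type u) [MetricSpace X] : AreaExtension X where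
  carrier := X
  incl := id
  isometry_incl := isometry_id
  disc_or_cylinder := by simp

theorem trivial_excess : (trivial X).excess = 0 := by
  simp only [excess, ENNReal.tsum_eq_zero]
  rintro ⟨C, x, hx, -⟩
  exact absurd ⟨x, rfl⟩ hx

/-- In a union of two disjoint relatively open pieces, one of which is an isometric image,
components are computed in that piece. -/
theorem component_image {Y Z : Type u} [MetricSpace Y] [MetricSpace Z] {f : Y → Z}
    (hf : Isometry f) {S : Set Y} {V : Set Z} (hU : IsOpen (f '' S)) (hV : IsOpen V)
    (hd : Disjoint (f '' S) V) {x : Y} (hx : x ∈ S) :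
    connectedComponentIn (f '' S ∪ V) (f x) = f '' connectedComponentIn S x := by
  apply Subset.antisymm
  · have hmem : f x ∈ f '' S ∪ V := Or.inl ⟨x, hx, rfl⟩
    have hpre : IsPreconnected (connectedComponentIn (f '' S ∪ V) (f x)) :=
      isPreconnected_connectedComponentIn
    have hsub : connectedComponentIn (f '' S ∪ V) (f x) ⊆ f '' S :=
      hpre.subset_left_of_subset_union hU hV hd (connectedComponentIn_subset _ _)
        ⟨f x, mem_connectedComponentIn hmem, ⟨x, hx, rfl⟩⟩
    obtain ⟨T, hTS, hT⟩ := subset_image_iff.1 hsub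
    rw [← hT] at hpre ⊢
    refine image_mono ?_
    refine IsPreconnected.subset_connectedComponentIn ?_ ?_ hTS
    · exact (hf.isEmbedding.isInducing.isPreconnected_image).1 hpre
    · have h1 := mem_connectedComponentIn hmem
      rw [← hT] at h1
      obtain ⟨y, hy, hyx⟩ := h1
      exact hf.injective hyx ▸ hy
  · refine IsPreconnected.subset_connectedComponentIn ?_ ?_ ?_
    · exact (isPreconnected_connectedComponentIn).image f hf.continuous.continuousOn
    · exact ⟨x, mem_connectedComponentIn hx, rfl⟩
    · exact (image_mono (connectedComponentIn_subset _ _)).trans subset_union_left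

theorem dist_glue_pos [CompleteSpace X] [Nonempty X] (E F : AreaExtension X) {x : E.carrier} (hx : x ∈ (range E.incl)ᶜ) :
    ∃ r > 0, ∀ y : F.carrier,
      r ≤ dist (Metric.toGlueL E.isometry_incl F.isometry_incl x)
        (Metric.toGlueR E.isometry_incl F.isometry_incl y) := by
  have hcl : IsClosed (range E.incl) := E.isometry_incl.isClosedEmbedding.isClosed_range
  have hne : (range E.incl).Nonempty := range_nonempty _
  refine ⟨Metric.infDist x (range E.incl), (hcl.notMem_iff_infDist_pos hne).1 hx, fun y => ?_⟩
  change _ ≤ Metric.glueDist E.incl F.incl 0 (.inl x) (.inr y)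
  simp only [Metric.glueDist, add_zero]
  refine le_ciInf fun p => ?_
  have := Metric.infDist_le_dist_of_mem (x := x) (mem_range_self (f := E.incl) p)
  linarith [dist_nonneg (x := y) (y := F.incl p)]

theorem dist_glue_pos' [CompleteSpace X] [Nonempty X]
    (E F : AreaExtension X) {y : F.carrier} (hy : y ∈ (range F.incl)ᶜ) :
    ∃ r > 0, ∀ x : E.carrier,
      r ≤ dist (Metric.toGlueR E.isometry_incl F.isometry_incl y)
        (Metric.toGlueL E.isometry_incl F.isometry_incl x) := by
  have hcl : IsClosed (range F.incl) := F.isometry_incl.isClosedEmbedding.isClosed_range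
  have hne : (range F.incl).Nonempty := range_nonempty _
  refine ⟨Metric.infDist y (range F.incl), (hcl.notMem_iff_infDist_pos hne).1 hy, fun x => ?_⟩
  change _ ≤ Metric.glueDist E.incl F.incl 0 (.inr y) (.inl x)
  simp only [Metric.glueDist, add_zero]
  refine le_ciInf fun p => ?_
  have := Metric.infDist_le_dist_of_mem (x := y) (mem_range_self (f := F.incl) p)
  linarith [dist_nonneg (x := x) (y := E.incl p)]

theorem glue_surj [Nonempty X] (E F : AreaExtension X)
    (z : Metric.GlueSpace E.isometry_incl F.isometry_incl) :
    (∃ x, Metric.toGlueL E.isometry_incl F.isometry_incl x = z) ∨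
    (∃ y, Metric.toGlueR E.isometry_incl F.isometry_incl y = z) := by
  induction z using Quotient.inductionOn' with
  | h p =>
    rcases p with x | y
    · exact Or.inl ⟨x, rfl⟩
    · exact Or.inr ⟨y, rfl⟩

/-- The complement of `X` in the space glued from two extensions is the disjoint union of the two
complements, and both pieces are open. -/
theorem glue_complement [CompleteSpace X] [Nonempty X]
    (E F : AreaExtension X) :
    let L := Metric.toGlueL E.isometry_incl F.isometry_incl
    let R := Metric.toGlueR E.isometry_incl F.isometry_incl
    (range (L ∘ E.incl))ᶜ = L '' (range E.incl)ᶜ ∪ R '' (range F.incl)ᶜ ∧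
    IsOpen (L '' (range E.incl)ᶜ) ∧ IsOpen (R '' (range F.incl)ᶜ) ∧
    Disjoint (L '' (range E.incl)ᶜ) (R '' (range F.incl)ᶜ) := by
  intro L R
  have hLi : Isometry L := Metric.toGlueL_isometry _ _
  have hRi : Isometry R := Metric.toGlueR_isometry _ _
  have hcomm : ∀ p, L (E.incl p) = R (F.incl p) := fun p =>
    congrFun (Metric.toGlue_commute E.isometry_incl F.isometry_incl) p
  have hsep : ∀ x ∈ (range E.incl)ᶜ, ∀ y, L x ≠ R y := by
    intro x hx y h
    obtain ⟨r, hr, h'⟩ := dist_glue_pos E F hx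
    have := h' y
    change r ≤ dist (L x) (R y) at this
    rw [h, dist_self] at this
    linarith
  have hsep' : ∀ y ∈ (range F.incl)ᶜ, ∀ x, R y ≠ L x := by
    intro y hy x h
    obtain ⟨r, hr, h'⟩ := dist_glue_pos' E F hy
    have := h' x
    change r ≤ dist (R y) (L x) at this
    rw [h, dist_self] at this
    linarith
  have hclE : IsClosed (range E.incl) := E.isometry_incl.isClosedEmbedding.isClosed_range
  have hclF : IsClosed (range F.incl) := F.isometry_incl.isClosedEmbedding.isClosed_range
  refine ⟨?_, ?_, ?_, ?_⟩
  · ext z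
    constructor
    · intro hz
      rcases glue_surj E F z with ⟨x, rfl⟩ | ⟨y, rfl⟩
      · refine Or.inl ⟨x, ?_, rfl⟩
        rintro ⟨p, rfl⟩
        exact hz ⟨p, rfl⟩
      · refine Or.inr ⟨y, ?_, rfl⟩
        rintro ⟨p, rfl⟩
        exact hz ⟨p, hcomm p⟩
    · rintro (⟨x, hx, rfl⟩ | ⟨y, hy, rfl⟩) ⟨p, hp⟩
      · exact hx ⟨p, hLi.injective hp⟩
      · exact hsep' y hy _ hp.symm
  · rw [Metric.isOpen_iff]
    rintro _ ⟨x, hx, rfl⟩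
    obtain ⟨r, hr, h⟩ := dist_glue_pos E F hx
    refine ⟨r, hr, fun z hz => ?_⟩
    rw [Metric.mem_ball, dist_comm] at hz
    rcases glue_surj E F z with ⟨x', rfl⟩ | ⟨y, rfl⟩
    · refine ⟨x', ?_, rfl⟩
      rintro ⟨p, rfl⟩
      have h2 := h (F.incl p)
      rw [← show L (E.incl p) = Metric.toGlueR E.isometry_incl F.isometry_incl (F.incl p) from
        hcomm p] at h2
      exact absurd hz (not_lt.2 h2)
    · exact absurd hz (not_lt.2 (h y))
  · rw [Metric.isOpen_iff]
    rintro _ ⟨y, hy, rfl⟩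
    obtain ⟨r, hr, h⟩ := dist_glue_pos' E F hy
    refine ⟨r, hr, fun z hz => ?_⟩
    rw [Metric.mem_ball, dist_comm] at hz
    rcases glue_surj E F z with ⟨x, rfl⟩ | ⟨y', rfl⟩
    · exact absurd hz (not_lt.2 (h x))
    · refine ⟨y', ?_, rfl⟩
      rintro ⟨p, rfl⟩
      have h2 := h (E.incl p)
      rw [show Metric.toGlueL E.isometry_incl F.isometry_incl (E.incl p) = R (F.incl p) from
        hcomm p] at h2
      exact absurd hz (not_lt.2 h2)
  · rw [Set.disjoint_left]
    rintro _ ⟨x, hx, rfl⟩ ⟨y, -, h⟩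
    exact hsep x hx y h.symm

/-- Components of the complement of `X` in the glued space. -/
theorem glue_component [CompleteSpace X] [Nonempty X]
    (E F : AreaExtension X)
    {z : Metric.GlueSpace E.isometry_incl F.isometry_incl}
    (hz : z ∈ (range (Metric.toGlueL E.isometry_incl F.isometry_incl ∘ E.incl))ᶜ) :
    (∃ x ∈ (range E.incl)ᶜ,
      connectedComponentIn (range (Metric.toGlueL E.isometry_incl F.isometry_incl ∘ E.incl))ᶜ z =
        Metric.toGlueL E.isometry_incl F.isometry_incl ''
          connectedComponentIn (range E.incl)ᶜ x) ∨
    (∃ y ∈ (range F.incl)ᶜ,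
      connectedComponentIn (range (Metric.toGlueL E.isometry_incl F.isometry_incl ∘ E.incl))ᶜ z =
        Metric.toGlueR E.isometry_incl F.isometry_incl ''
          connectedComponentIn (range F.incl)ᶜ y) := by
  obtain ⟨h1, hL, hR, hd⟩ := glue_complement E F
  rw [h1] at hz ⊢
  rcases hz with ⟨x, hx, rfl⟩ | ⟨y, hy, rfl⟩
  · exact Or.inl ⟨x, hx, component_image (Metric.toGlueL_isometry _ _) hL hR hd hx⟩
  · refine Or.inr ⟨y, hy, ?_⟩
    rw [union_comm]
    exact component_image (Metric.toGlueR_isometry _ _) hR hL hd.symm hy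

/-- The union of two area extensions, glued along `X`. -/
def glue [CompleteSpace X] [Nonempty X]
    (E F : AreaExtension X) : AreaExtension X where
  carrier := Metric.GlueSpace E.isometry_incl F.isometry_incl
  incl := Metric.toGlueL E.isometry_incl F.isometry_incl ∘ E.incl
  isometry_incl := (Metric.toGlueL_isometry _ _).comp E.isometry_incl
  disc_or_cylinder := by
    intro z hz
    rcases glue_component E F hz with ⟨x, hx, h⟩ | ⟨y, hy, h⟩
    · rw [h]
      have e := ((Metric.toGlueL_isometry E.isometry_incl F.isometry_incl).isEmbedding.homeomorphImage
        (connectedComponentIn (range E.incl)ᶜ x)).symm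
      exact (E.disc_or_cylinder x hx).imp (fun ⟨e'⟩ => ⟨e.trans e'⟩) (fun ⟨e'⟩ => ⟨e.trans e'⟩)
    · rw [h]
      have e := ((Metric.toGlueR_isometry E.isometry_incl F.isometry_incl).isEmbedding.homeomorphImage
        (connectedComponentIn (range F.incl)ᶜ y)).symm
      exact (F.disc_or_cylinder y hy).imp (fun ⟨e'⟩ => ⟨e.trans e'⟩) (fun ⟨e'⟩ => ⟨e.trans e'⟩)

theorem glue_excess_le [CompleteSpace X] [Nonempty X]
    (E F : AreaExtension X) : (glue E F).excess ≤ E.excess + F.excess := by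
  let L : E.carrier → (glue E F).carrier := Metric.toGlueL E.isometry_incl F.isometry_incl
  let R : F.carrier → (glue E F).carrier := Metric.toGlueR E.isometry_incl F.isometry_incl
  have hL : Isometry L := Metric.toGlueL_isometry _ _
  have hR : Isometry R := Metric.toGlueR_isometry _ _
  have hsub : (glue E F).components ⊆
      (fun C => L '' C) '' E.components ∪ (fun C => R '' C) '' F.components := by
    rintro _ ⟨z, hz, rfl⟩
    rcases glue_component E F hz with ⟨x, hx, h⟩ | ⟨y, hy, h⟩
    · exact Or.inl ⟨_, ⟨x, hx, rfl⟩, h.symm⟩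
    · exact Or.inr ⟨_, ⟨y, hy, rfl⟩, h.symm⟩
  let φ : Set (glue E F).carrier → ℝ≥0∞ := fun C => area C
  have e1 : ∑' C : ((fun C => L '' C) '' E.components : Set (Set (glue E F).carrier)), φ C =
      E.excess := by
    rw [tsum_image φ (hL.injective.image_injective.injOn)]
    exact tsum_congr fun C => area_image hL _
  have e2 : ∑' C : ((fun C => R '' C) '' F.components : Set (Set (glue E F).carrier)), φ C =
      F.excess := by
    rw [tsum_image φ (hR.injective.image_injective.injOn)]
    exact tsum_congr fun C => area_image hR _
  calc (glue E F).excess ≤ _ := ENNReal.tsum_mono_subtype φ hsub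
    _ ≤ _ := ENNReal.tsum_union_le φ _ _
    _ = _ := by rw [e1, e2]

theorem glue_H1map_left {Γ : Type u} [AddCommGroup Γ] [CompleteSpace X] [Nonempty X]
    (E F : AreaExtension X) {a b : H1 Γ X}
    (h : H1map Γ E.hom a = H1map Γ E.hom b) :
    H1map Γ (glue E F).hom a = H1map Γ (glue E F).hom b := by
  let L : TopCat.of E.carrier ⟶ TopCat.of (glue E F).carrier :=
    TopCat.ofHom ⟨_, (Metric.toGlueL_isometry E.isometry_incl F.isometry_incl).continuous⟩
  have hh : (glue E F).hom = E.hom ≫ L := rfl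
  rw [hh, H1map_comp, H1map_comp, h]

theorem glue_H1map_right {Γ : Type u} [AddCommGroup Γ] [CompleteSpace X] [Nonempty X]
    (E F : AreaExtension X) {a b : H1 Γ X}
    (h : H1map Γ F.hom a = H1map Γ F.hom b) :
    H1map Γ (glue E F).hom a = H1map Γ (glue E F).hom b := by
  let R : TopCat.of F.carrier ⟶ TopCat.of (glue E F).carrier :=
    TopCat.ofHom ⟨_, (Metric.toGlueR_isometry E.isometry_incl F.isometry_incl).continuous⟩
  have hh : (glue E F).hom = F.hom ≫ R := by
    ext p
    exact congrFun (Metric.toGlue_commute E.isometry_incl F.isometry_incl) p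
  rw [hh, H1map_comp, H1map_comp, h]

end AreaExtension

variable {Γ : Type u} [AddCommGroup Γ] {X : Type u} [MetricSpace X]

theorem d₁_self (a : H1 Γ X) : d₁ a a = 0 :=
  le_antisymm ((iInf₂_le (f := fun (E : AreaExtension X)
    (_ : H1map Γ E.hom a = H1map Γ E.hom a) => E.excess) (AreaExtension.trivial X) rfl).trans
    AreaExtension.trivial_excess.le) zero_le

theorem d₁_comm (a b : H1 Γ X) : d₁ a b = d₁ b a := by
  simp only [d₁, eq_comm]

theorem d₁_triangle [CompleteSpace X] [Nonempty X] (a b c : H1 Γ X) :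
    d₁ a c ≤ d₁ a b + d₁ b c := by
  simp only [d₁]
  refine ENNReal.le_of_forall_pos_le_add fun ε hε hlt => ?_
  have hε' : ((ε : ℝ≥0∞) / 2) ≠ 0 := by simpa using hε.ne'
  have h1 : (⨅ (E : AreaExtension X) (_ : H1map Γ E.hom a = H1map Γ E.hom b), E.excess) <
      (⨅ (E : AreaExtension X) (_ : H1map Γ E.hom a = H1map Γ E.hom b), E.excess) + ε / 2 :=
    ENNReal.lt_add_right (lt_of_le_of_lt le_self_add hlt).ne hε'
  have h2 : (⨅ (E : AreaExtension X) (_ : H1map Γ E.hom b = H1map Γ E.hom c), E.excess) <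
      (⨅ (E : AreaExtension X) (_ : H1map Γ E.hom b = H1map Γ E.hom c), E.excess) + ε / 2 :=
    ENNReal.lt_add_right (lt_of_le_of_lt le_add_self hlt).ne hε'
  obtain ⟨E, hE, hE'⟩ : ∃ E : AreaExtension X, ∃ _ : H1map Γ E.hom a = H1map Γ E.hom b, E.excess < _ := by
    simpa only [iInf_lt_iff] using h1
  obtain ⟨F, hF, hF'⟩ : ∃ F : AreaExtension X, ∃ _ : H1map Γ F.hom b = H1map Γ F.hom c, F.excess < _ := by
    simpa only [iInf_lt_iff] using h2
  refine (iInf₂_le (E.glue F) ((E.glue_H1map_left F hE).trans (E.glue_H1map_right F hF))).trans ?_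
  refine (E.glue_excess_le F).trans ((add_le_add hE'.le hF'.le).trans (le_of_eq ?_))
  rw [add_add_add_comm, ENNReal.add_halves]

theorem d₁_sub_sub_right (a b c : H1 Γ X) : d₁ (a - c) (b - c) = d₁ a b := by
  simp only [d₁, map_sub, sub_left_inj]

theorem d₁_sub_sub_left (a b c : H1 Γ X) : d₁ (c - a) (c - b) = d₁ a b := by
  simp only [d₁, map_sub, sub_right_inj]

end Helpers

/-! ### The groups `H_d(X)` and `Ĥ_d(X)` -/

section Groups

variable (Γ : Type u) [AddCommGroup Γ] (X : Type u) [MetricSpace X] [CompleteSpace X] [Nonempty X]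

/-- `H₁(X; Γ)` with the (extended) pseudo-metric `d₁`. -/
instance : PseudoEMetricSpace (H1 Γ X) where
  edist := d₁
  edist_self := d₁_self
  edist_comm := d₁_comm
  edist_triangle := d₁_triangle

instance : IsUniformAddGroup (H1 Γ X) := by
  refine ⟨EMetric.uniformContinuous_iff.2 fun ε hε => ⟨ε / 2, ENNReal.half_pos hε.ne', ?_⟩⟩
  rintro ⟨a, b⟩ ⟨c, d⟩ h
  obtain ⟨h1, h2⟩ := max_lt_iff.1 h
  calc edist (a - b) (c - d) ≤ edist (a - b) (c - b) + edist (c - b) (c - d) :=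
        edist_triangle _ _ _
    _ = edist a c + edist b d := by
        congr 1
        · exact d₁_sub_sub_right a c b
        · exact d₁_sub_sub_left b d c
    _ < ε / 2 + ε / 2 := ENNReal.add_lt_add h1 h2
    _ = ε := ENNReal.add_halves ε

/-- `H_d(X)`: the quotient of `H₁(X; Γ)` identifying classes at distance zero, with the induced
metric and group structure. -/
abbrev Hd : Type u := SeparationQuotient (H1 Γ X)

/-- `Ĥ_d(X)`: the completion of `H_d(X)` with respect to `d₁`, with the group operation extended by
continuity. -/
abbrev HdHat : Type u := UniformSpace.Completion (Hd Γ X)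

/-- The canonical map `H₁(X; Γ) → Ĥ_d(X)`. -/
def toHdHat (c : H1 Γ X) : HdHat Γ X := ((SeparationQuotient.mk c : Hd Γ X) : HdHat Γ X)

end Groups

/-! ### The fundamental loop of the circle -/

/-- The singular 1-simplex `(1 - t, t) ↦ exp(2πit)` traversing the unit circle once. -/
def fundamentalLoop : C(stdSimplex ℝ (Fin 2), Circle) where
  toFun p := Circle.exp (2 * Real.pi * p.1 1)
  continuous_toFun := Circle.exp.continuous.comp
    (continuous_const.mul ((continuous_apply 1).comp continuous_subtype_val))

end

/-!
An area extension `X'` of the circle with excess area less than `1` cannot kill any homology class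
of the circle.

The inclusion of the circle in the plane extends to a map `f : X' → ℝ × ℝ` that is `1`-Lipschitz
for the sup metric (`AreaExtension.exists_lipschitz_extension`). Such a map does not increase area,
and for the sup metric the Hausdorff measure built from `∑ diam²` is Lebesgue measure. Hence the
image of countably many components of `X' \ S¹` has Lebesgue measure less than `1` and misses a
point `p` of a unit square inside the open disc. Projecting radially from `p` retracts the union of
the circle with these components onto the circle (`AreaExtension.exists_retraction`).

There may be uncountably many components, but a singular chain meets only countably many of them
(`exists_countable_components_cover_range`, `exists_finite_support`). So if the image in `X'` of a
chain of the circle bounds, it bounds in a subspace that retracts onto the circle, and the chain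
bounds in the circle itself (`isNullHomologous_of_excess_lt_one`).

Therefore distinct classes in `H₁(S¹)` have `d₁`-distance at least `1`: the pseudo-metric is a
uniformly discrete metric, and the canonical map to the completion is bijective. The lower bound
for the excess area of a filling of `g · σ` reduces to `g · σ` not bounding in the circle, which is
seen from the integral winding cocycle (`sum_winding_faces`).
-/

/-! ### Retracting small extensions onto the circle -/

/-- For `p` in the open unit disc, pushing along rays from `p` retracts `ℂ \ {p}` onto the unit
circle. A true retraction makes homotopy invariance of homology unnecessary. -/
theorem exists_radial_retraction {p : ℂ} (hp : ‖p‖ < 1) :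
    ∃ ρ : C({q : ℂ // q ≠ p}, Circle), ∀ q : {q : ℂ // q ≠ p}, ‖(q : ℂ)‖ = 1 → (ρ q : ℂ) = q := by
  let a : {q : ℂ // q ≠ p} → ℝ := fun q => Complex.normSq (q - p)
  let b : {q : ℂ // q ≠ p} → ℝ := fun q => p.re * ((q : ℂ) - p).re + p.im * ((q : ℂ) - p).im
  -- `p + t (q - p)` is the point where the ray from `p` through `q` leaves the unit disc:
  -- `t` is the larger root of `a t² + 2 b t = 1 - |p|²`.
  let t : {q : ℂ // q ≠ p} → ℝ := fun q =>
    (-b q + √(b q ^ 2 + a q * (1 - Complex.normSq p))) / a q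
  have hp' : Complex.normSq p < 1 := by
    rw [Complex.normSq_eq_norm_sq]
    nlinarith [norm_nonneg p]
  have ha : ∀ q, 0 < a q := fun q => Complex.normSq_pos.2 (sub_ne_zero.2 q.2)
  have hnorm : ∀ q, Complex.normSq (p + t q * ((q : ℂ) - p)) = 1 := by
    intro q
    have hs := Real.sq_sqrt (show 0 ≤ b q ^ 2 + a q * (1 - Complex.normSq p) from
      add_nonneg (sq_nonneg _) (mul_nonneg (ha q).le (by linarith)))
    have ht : a q * t q + b q = √(b q ^ 2 + a q * (1 - Complex.normSq p)) := by
      simp only [t]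
      field_simp [(ha q).ne']
      ring
    rw [← ht] at hs
    have hexp : Complex.normSq (p + t q * ((q : ℂ) - p)) =
        Complex.normSq p + 2 * t q * b q + t q ^ 2 * a q := by
      simp only [Complex.normSq_apply, a, b, Complex.add_re, Complex.add_im, Complex.mul_re,
        Complex.mul_im, Complex.ofReal_re, Complex.ofReal_im]
      ring
    rw [hexp]
    have := (ha q).ne'
    apply mul_left_cancel₀ this
    linarith
  have hac : Continuous a := Complex.continuous_normSq.comp (by fun_prop)
  have hbc : Continuous b := by fun_prop
  have htc : Continuous t := by
    refine Continuous.div (by fun_prop) hac fun q => (ha q).ne'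
  refine ⟨⟨fun q => ⟨p + t q * ((q : ℂ) - p), ?_⟩, ?_⟩, ?_⟩
  · refine mem_sphere_zero_iff_norm.2 ?_
    rw [← sq_eq_sq₀ (norm_nonneg _) zero_le_one, ← Complex.normSq_eq_norm_sq, hnorm, one_pow]
  · exact Continuous.subtype_mk (by fun_prop) _
  · intro q hq
    have h1 : Complex.normSq (q : ℂ) = 1 := by rw [Complex.normSq_eq_norm_sq, hq, one_pow]
    have h2 : 1 = Complex.normSq p + 2 * b q + a q := by
      rw [← h1]
      simp only [Complex.normSq_apply, a, b, Complex.sub_re, Complex.sub_im]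
      ring
    have h3 : t q = 1 := by
      have : b q ^ 2 + a q * (1 - Complex.normSq p) = (a q + b q) ^ 2 := by
        rw [show 1 - Complex.normSq p = 2 * b q + a q by linarith]; ring
      simp only [t]
      rw [this, Real.sqrt_sq (by linarith [ha q]), div_eq_one_iff_eq (ha q).ne']
      ring
    change p + (t q : ℂ) * ((q : ℂ) - p) = q
    simp [h3]

/-- A `1`-Lipschitz map to the plane with the sup metric does not increase area. For the sup
metric the unnormalised two-dimensional Hausdorff measure is exactly Lebesgue measure. -/
theorem area_image_le_of_lipschitz {Y : Type u} [MetricSpace Y] {f : Y → ℝ × ℝ}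
    (hf : LipschitzWith 1 f) (A : Set Y) : volume (f '' A) ≤ area A := by
  let _ : MeasurableSpace Y := borel Y
  have _ : BorelSpace Y := ⟨rfl⟩
  rw [← hausdorffMeasure_prod_real]
  have h := hf.hausdorffMeasure_image_le (d := 2) zero_le_two A
  simp only [ENNReal.coe_one, ENNReal.one_rpow, one_mul] at h
  exact h

namespace AreaExtension

theorem volume_image_sUnion_le {X : Type u} [MetricSpace X] (E : AreaExtension X)
    {f : E.carrier → ℝ × ℝ} (hf : LipschitzWith 1 f)
    {T : Set (Set E.carrier)} (hT : T.Countable) (hTE : T ⊆ E.components) :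
    volume (f '' ⋃₀ T) ≤ E.excess := by
  rw [sUnion_eq_biUnion, image_iUnion₂]
  calc volume (⋃ C ∈ T, f '' C) ≤ ∑' C : T, volume (f '' (C : Set E.carrier)) :=
        measure_biUnion_le volume hT _
    _ ≤ ∑' C : T, area (C : Set E.carrier) :=
        ENNReal.tsum_le_tsum fun C => area_image_le_of_lipschitz hf _
    _ ≤ E.excess := ENNReal.tsum_mono_subtype (fun C => area C) hTE

/-- The two coordinate functions of the circle extend to `1`-Lipschitz functions (McShane), so the
inclusion of the circle in the plane extends to a map that is `1`-Lipschitz for the sup metric. -/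
theorem exists_lipschitz_extension (E : AreaExtension Circle) :
    ∃ f : E.carrier → ℝ × ℝ, LipschitzWith 1 f ∧
      ∀ z : Circle, f (E.incl z) = ((z : ℂ).re, (z : ℂ).im) := by
  have key : ∀ φ : ℂ → ℝ, LipschitzWith 1 φ →
      ∃ f : E.carrier → ℝ, LipschitzWith 1 f ∧ ∀ z : Circle, f (E.incl z) = φ z := by
    intro φ hφ
    have hinj := E.isometry_incl.injective
    have hL : LipschitzOnWith 1 (fun x => φ (Function.invFun E.incl x : Circle)) (range E.incl) := by
      rintro _ ⟨z, rfl⟩ _ ⟨w, rfl⟩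
      simp only [Function.leftInverse_invFun hinj _]
      rw [E.isometry_incl.edist_eq]
      exact hφ _ _
    obtain ⟨f, hf, hfe⟩ := hL.extend_real
    refine ⟨f, hf, fun z => ?_⟩
    rw [← hfe (mem_range_self z)]
    simp only [Function.leftInverse_invFun hinj _]
  obtain ⟨f, hf, hf'⟩ := key Complex.re (LipschitzWith.of_dist_le_mul fun x y => by
    rw [NNReal.coe_one, one_mul, Real.dist_eq, ← Complex.sub_re, dist_eq_norm]
    exact Complex.abs_re_le_norm _)
  obtain ⟨g, hg, hg'⟩ := key Complex.im (LipschitzWith.of_dist_le_mul fun x y => by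
    rw [NNReal.coe_one, one_mul, Real.dist_eq, ← Complex.sub_im, dist_eq_norm]
    exact Complex.abs_im_le_norm _)
  refine ⟨fun x => (f x, g x), by simpa using hf.prodMk hg, fun z => by simp [hf', hg']⟩

/-- If the excess area is less than `1`, the circle is a retract of its union with countably many
complementary components. Countability is what bounds the measure of the image of the union by the
sum of the areas. -/
theorem exists_retraction (E : AreaExtension Circle) (hE : E.excess < 1)
    {T : Set (Set E.carrier)} (hT : T.Countable) (hTE : T ⊆ E.components)
    {Y : Set E.carrier} (hY : Y ⊆ range E.incl ∪ ⋃₀ T) :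
    ∃ r : C(Y, Circle), ∀ z (hz : E.incl z ∈ Y), r ⟨E.incl z, hz⟩ = z := by
  obtain ⟨f, hf, hfE⟩ := E.exists_lipschitz_extension
  -- A square of area `1` inside the open disc: the image of the components cannot cover it.
  let Q : Set (ℝ × ℝ) := Icc (-1 / 2) (1 / 2) ×ˢ Icc (-1 / 2) (1 / 2)
  have hQ : volume Q = 1 := by
    rw [Measure.volume_eq_prod, Measure.prod_prod, Real.volume_Icc]
    norm_num
  obtain ⟨⟨a, b⟩, hab, hab'⟩ : (Q \ f '' ⋃₀ T).Nonempty := by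
    rw [nonempty_iff_ne_empty, Ne, sdiff_eq_empty]
    intro h
    have := (measure_mono h).trans (E.volume_image_sUnion_le hf hT hTE)
    rw [hQ] at this
    exact absurd hE this.not_gt
  have hp2 : a ^ 2 + b ^ 2 < 1 := by
    obtain ⟨⟨h1, h2⟩, h3, h4⟩ := hab
    simp only at h1 h2 h3 h4
    nlinarith
  have hp : ‖(⟨a, b⟩ : ℂ)‖ < 1 := by
    rw [← sq_lt_one_iff₀ (norm_nonneg _), ← Complex.normSq_eq_norm_sq, Complex.normSq_apply]
    linarith
  obtain ⟨ρ, hρ⟩ := exists_radial_retraction hp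
  have hmiss : ∀ y : Y, (⟨(f y).1, (f y).2⟩ : ℂ) ≠ ⟨a, b⟩ := by
    rintro ⟨y, hy⟩ h
    have h1 : (f y).1 = a := congrArg Complex.re h
    have h2 : (f y).2 = b := congrArg Complex.im h
    rcases hY hy with ⟨z, rfl⟩ | hy
    · rw [hfE] at h1 h2
      have := z.normSq_coe
      rw [Complex.normSq_apply] at this
      simp only at h1 h2
      subst h1 h2
      linarith
    · exact hab' ⟨y, hy, Prod.ext h1 h2⟩
  have hcont : Continuous fun y : Y => (⟨(f y).1, (f y).2⟩ : ℂ) := by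
    have := hf.continuous
    exact Complex.equivRealProdCLM.symm.continuous.comp (this.comp continuous_subtype_val)
  refine ⟨ρ.comp ⟨fun y => ⟨_, hmiss y⟩, hcont.subtype_mk _⟩, fun z hz => ?_⟩
  apply Circle.ext
  have hz' : (⟨(f (E.incl z)).1, (f (E.incl z)).2⟩ : ℂ) = z := by simp [hfE]
  simp only [ContinuousMap.comp_apply, ContinuousMap.coe_mk]
  rw [hρ _ (by simp only [hz']; exact z.norm_coe)]
  exact hz'

end AreaExtension

/-- A map from a separable, locally connected space meets only countably many complementary
components: the preimage of the complement has open components, each of which contains a point of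
a countable dense set. -/
theorem exists_countable_components_cover_range {X : Type u} [MetricSpace X] [CompleteSpace X]
    (E : AreaExtension X) {D : Type*} [TopologicalSpace D] [TopologicalSpace.SeparableSpace D]
    [LocallyConnectedSpace D] (σ : C(D, E.carrier)) :
    ∃ T : Set (Set E.carrier), T.Countable ∧ T ⊆ E.components ∧
      range σ ⊆ range E.incl ∪ ⋃₀ T := by
  obtain ⟨Q, hQc, hQd⟩ := TopologicalSpace.exists_countable_dense D
  refine ⟨(fun q => connectedComponentIn (range E.incl)ᶜ (σ q)) '' (Q ∩ σ ⁻¹' (range E.incl)ᶜ),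
    (hQc.mono inter_subset_left).image _, ?_, ?_⟩
  · rintro _ ⟨q, hq, rfl⟩
    exact ⟨σ q, hq.2, rfl⟩
  · rintro _ ⟨x, rfl⟩
    by_cases hx : σ x ∈ range E.incl
    · exact Or.inl hx
    have hU : IsOpen (σ ⁻¹' (range E.incl)ᶜ) :=
      E.isometry_incl.isClosedEmbedding.isClosed_range.isOpen_compl.preimage σ.continuous
    obtain ⟨q, hqV, hqQ⟩ := hQd.inter_open_nonempty _ (hU.connectedComponentIn (x := x))
      ⟨x, mem_connectedComponentIn hx⟩
    have hq : σ q ∈ (range E.incl)ᶜ :=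
      connectedComponentIn_subset (σ ⁻¹' (range E.incl)ᶜ) x hqV
    refine Or.inr ⟨_, ⟨q, ⟨hqQ, hq⟩, rfl⟩, ?_⟩
    have hpre : IsPreconnected (σ '' connectedComponentIn (σ ⁻¹' (range E.incl)ᶜ) x) :=
      isPreconnected_connectedComponentIn.image _ σ.continuous.continuousOn
    refine hpre.subset_connectedComponentIn ⟨q, hqV, rfl⟩ ?_ ⟨x, mem_connectedComponentIn hx, rfl⟩
    rintro _ ⟨y, hy, rfl⟩
    exact connectedComponentIn_subset (σ ⁻¹' (range E.incl)ᶜ) x hy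

/-! ### Singular chains -/

section Chains

variable {Γ : Type u} [AddCommGroup Γ]

/-- The chain map induced on singular chains by a continuous map. -/
noncomputable abbrev chainsMap (Γ : Type u) [AddCommGroup Γ] {X Y : Type u} [TopologicalSpace X]
    [TopologicalSpace Y] (f : TopCat.of X ⟶ TopCat.of Y) :
    singularChains Γ X ⟶ singularChains Γ Y :=
  ((singularChainComplexFunctor AddCommGrpCat.{u}).obj (AddCommGrpCat.of Γ)).map f

/-- The elementary singular `n`-chain `g · σ`. -/
noncomputable def simplexChain {X : Type u} [TopologicalSpace X] {n : ℕ}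
    (σ : C(stdSimplex ℝ (Fin (n + 1)), X)) (g : Γ) : (singularChains Γ X).X n :=
  ConcreteCategory.hom (C := AddCommGrpCat.{u}) (SSet.ιChainComplex (R := AddCommGrpCat.of Γ)
    (TopCat.toSSet.obj (TopCat.of X))
    ((TopCat.toSSetObjEquiv (TopCat.of X) (Opposite.op ⦋n⦌)).symm σ)) g

theorem elemChain_eq {X : Type u} [TopologicalSpace X] (g : Γ) (σ : C(stdSimplex ℝ (Fin 2), X)) :
    elemChain g σ = simplexChain (n := 1) σ g := rfl

theorem chainsMap_simplexChain {X Y : Type u} [TopologicalSpace X] [TopologicalSpace Y] {n : ℕ}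
    (f : C(X, Y)) (σ : C(stdSimplex ℝ (Fin (n + 1)), X)) (g : Γ) :
    (chainsMap Γ (TopCat.ofHom f)).f n (simplexChain σ g) = simplexChain (f.comp σ) g := by
  have h := SSet.ι_chainComplexMap_f (TopCat.toSSet.obj (TopCat.of X))
    (TopCat.toSSet.obj (TopCat.of Y)) (TopCat.toSSet.map (TopCat.ofHom f)) (AddCommGrpCat.of Γ)
    ((TopCat.toSSetObjEquiv (TopCat.of X) (Opposite.op ⦋n⦌)).symm σ)
  exact ConcreteCategory.congr_hom h g

theorem d_simplexChain {X : Type u} [TopologicalSpace X] {n : ℕ}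
    (σ : C(stdSimplex ℝ (Fin (n + 2)), X)) (g : Γ) :
    (singularChains Γ X).d (n + 1) n (simplexChain (n := n + 1) σ g) =
      ∑ i : Fin (n + 2), (-1 : ℤ) ^ i.val •
        simplexChain (n := n)
          (σ.comp ⟨stdSimplex.map i.succAbove, stdSimplex.continuous_map _⟩) g := by
  have h := SSet.ιChainComplex_d (TopCat.toSSet.obj (TopCat.of X)) (R := AddCommGrpCat.of Γ)
    ((TopCat.toSSetObjEquiv (TopCat.of X) (Opposite.op ⦋n + 1⦌)).symm σ)
  refine (ConcreteCategory.congr_hom h g).trans ?_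
  let ev : (AddCommGrpCat.of Γ ⟶ (singularChains Γ X).X n) →+ (singularChains Γ X).X n :=
    AddMonoidHom.mk' (fun φ => φ.hom g) fun _ _ => rfl
  refine (map_sum ev _ _).trans (Finset.sum_congr rfl fun i _ => ?_)
  exact map_zsmul ev _ _

/-- Induction on singular chains: they are generated by the elementary chains, since the quotient
by the subgroup these generate receives only the zero map. -/
theorem chain_induction {X : Type u} [TopologicalSpace X] {n : ℕ}
    {P : (singularChains Γ X).X n → Prop} (b : (singularChains Γ X).X n)
    (zero : P 0) (add : ∀ x y, P x → P y → P (x + y)) (neg : ∀ x, P x → P (-x))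
    (simplex : ∀ (σ : C(stdSimplex ℝ (Fin (n + 1)), X)) (g : Γ), P (simplexChain σ g)) : P b := by
  let N : AddSubgroup ((singularChains Γ X).X n) :=
    { carrier := {x | P x}
      zero_mem' := zero
      add_mem' := fun hx hy => add _ _ hx hy
      neg_mem' := fun hx => neg _ hx }
  let π : (singularChains Γ X).X n ⟶ AddCommGrpCat.of ((singularChains Γ X).X n ⧸ N) :=
    AddCommGrpCat.ofHom (QuotientAddGroup.mk' N)
  have hπ : π = 0 := by
    refine SSet.chainComplex_hom_ext fun s => ?_
    ext g
    have hs := simplex (TopCat.toSSetObjEquiv (TopCat.of X) (Opposite.op ⦋n⦌) s) g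
    rw [simplexChain, Equiv.symm_apply_apply] at hs
    exact (QuotientAddGroup.eq_zero_iff _).2 hs
  have := ConcreteCategory.congr_hom hπ b
  exact (QuotientAddGroup.eq_zero_iff b).1 this

/-- Every chain involves finitely many simplices: it comes from any subspace containing their
images. -/
theorem exists_finite_support {X : Type u} [TopologicalSpace X] {n : ℕ}
    (b : (singularChains Γ X).X n) :
    ∃ S : Set C(stdSimplex ℝ (Fin (n + 1)), X), S.Finite ∧
      ∀ Y : Set X, (∀ σ ∈ S, range σ ⊆ Y) →
        ∃ b' : (singularChains Γ Y).X n,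
          (chainsMap Γ (TopCat.ofHom ⟨((↑) : Y → X), continuous_subtype_val⟩)).f n b' = b := by
  induction b using chain_induction with
  | zero => exact ⟨∅, finite_empty, fun Y _ => ⟨0, map_zero _⟩⟩
  | add x y hx hy =>
    obtain ⟨S, hS, hx⟩ := hx
    obtain ⟨T, hT, hy⟩ := hy
    refine ⟨S ∪ T, hS.union hT, fun Y hY => ?_⟩
    obtain ⟨x', hx'⟩ := hx Y fun σ h => hY σ (Or.inl h)
    obtain ⟨y', hy'⟩ := hy Y fun σ h => hY σ (Or.inr h)
    exact ⟨x' + y', by rw [map_add, hx', hy']⟩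
  | neg x hx =>
    obtain ⟨S, hS, hx⟩ := hx
    refine ⟨S, hS, fun Y hY => ?_⟩
    obtain ⟨x', hx'⟩ := hx Y hY
    exact ⟨-x', by rw [map_neg, hx']⟩
  | simplex σ g =>
    refine ⟨{σ}, finite_singleton σ, fun Y hY => ?_⟩
    refine ⟨simplexChain ⟨fun x => ⟨σ x, hY σ rfl (mem_range_self x)⟩,
      σ.continuous.subtype_mk _⟩ g, ?_⟩
    rw [chainsMap_simplexChain]
    rfl

theorem chainsMap_injective {X Y : Type u} [TopologicalSpace X] [TopologicalSpace Y]
    {f : C(X, Y)} (hf : Function.Injective f) (n : ℕ) :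
    Function.Injective ((chainsMap Γ (TopCat.ofHom f)).f n) := by
  have : Mono (TopCat.ofHom f) := (TopCat.mono_iff_injective _).2 hf
  exact (AddCommGrpCat.mono_iff_injective _).1 inferInstance

theorem chainsMap_comp_apply {X Y Z : Type u} [TopologicalSpace X] [TopologicalSpace Y]
    [TopologicalSpace Z] (f : TopCat.of X ⟶ TopCat.of Y) (g : TopCat.of Y ⟶ TopCat.of Z) {n : ℕ}
    (c : (singularChains Γ X).X n) :
    (chainsMap Γ (f ≫ g)).f n c = (chainsMap Γ g).f n ((chainsMap Γ f).f n c) := by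
  simp only [chainsMap, Functor.map_comp]
  rfl

theorem chainsMap_id_apply {X : Type u} [TopologicalSpace X] {n : ℕ}
    (c : (singularChains Γ X).X n) : (chainsMap Γ (𝟙 (TopCat.of X))).f n c = c := by
  simp [chainsMap]

theorem chainsMap_d {X Y : Type u} [TopologicalSpace X] [TopologicalSpace Y]
    (f : TopCat.of X ⟶ TopCat.of Y) {m n : ℕ} (c : (singularChains Γ X).X m) :
    (singularChains Γ Y).d m n ((chainsMap Γ f).f m c) =
      (chainsMap Γ f).f n ((singularChains Γ X).d m n c) :=
  ConcreteCategory.congr_hom ((chainsMap Γ f).comm m n) c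

/-- Homomorphisms from singular chains to `Γ` may be prescribed on elementary chains by an integer
weight for each simplex. -/
theorem exists_chain_hom {X : Type u} [TopologicalSpace X] {n : ℕ}
    (w : C(stdSimplex ℝ (Fin (n + 1)), X) → ℤ) :
    ∃ W : (singularChains Γ X).X n →+ Γ, ∀ σ g, W (simplexChain σ g) = w σ • g := by
  let φ : (singularChains Γ X).X n ⟶ AddCommGrpCat.of Γ :=
    Limits.Sigma.desc fun s : (TopCat.toSSet.obj (TopCat.of X)) _⦋n⦌ =>
      AddCommGrpCat.ofHom (zsmulAddGroupHom (α := Γ)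
        (w (TopCat.toSSetObjEquiv (TopCat.of X) (Opposite.op ⦋n⦌) s)))
  refine ⟨φ.hom, fun σ g => ?_⟩
  have h := Limits.Sigma.ι_desc (fun s : (TopCat.toSSet.obj (TopCat.of X)) _⦋n⦌ =>
      AddCommGrpCat.ofHom (zsmulAddGroupHom (α := Γ)
        (w (TopCat.toSSetObjEquiv (TopCat.of X) (Opposite.op ⦋n⦌) s))))
      ((TopCat.toSSetObjEquiv (TopCat.of X) (Opposite.op ⦋n⦌)).symm σ)
  refine (ConcreteCategory.congr_hom h g).trans ?_
  rw [Equiv.apply_symm_apply]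
  rfl

end Chains

/-! ### Small extensions of the circle kill no homology -/

instance (n : ℕ) : LocallyConnectedSpace (stdSimplex ℝ (Fin n)) :=
  have := (convex_stdSimplex ℝ (Fin n)).locallyPathConnectedSpace
  inferInstance

/-- An area extension of excess area less than `1` kills no homology of the circle. A bounding
chain `b` lives on the circle and countably many components, and this subspace `Y` retracts onto
the circle; the retraction carries `b`, seen in `Y`, to a chain whose boundary is `z`. -/
theorem isNullHomologous_of_excess_lt_one {Γ : Type} [AddCommGroup Γ] (E : AreaExtension Circle)
    (hE : E.excess < 1) {z : (singularChains Γ Circle).X 1}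
    (hz : IsNullHomologous ((chainsMap Γ E.hom).f 1 z)) : IsNullHomologous z := by
  obtain ⟨b, hb⟩ := hz
  obtain ⟨S, hS, hSb⟩ := exists_finite_support b
  choose T hTc hTE hT using fun σ : C(stdSimplex ℝ (Fin 3), E.carrier) =>
    exists_countable_components_cover_range E σ
  let Y : Set E.carrier := range E.incl ∪ ⋃₀ ⋃ σ ∈ S, T σ
  obtain ⟨b', hb'⟩ := hSb Y fun σ hσ => (hT σ).trans
    (union_subset_union_right _ (sUnion_subset_sUnion (subset_biUnion_of_mem hσ)))
  obtain ⟨r, hr⟩ := E.exists_retraction hE (hS.countable.biUnion fun σ _ => hTc σ)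
    (iUnion₂_subset fun σ _ => hTE σ) (Y := Y) subset_rfl
  let i : TopCat.of Circle ⟶ TopCat.of Y := TopCat.ofHom
    ⟨fun z => ⟨E.incl z, Or.inl (mem_range_self z)⟩, E.inclC.continuous.subtype_mk _⟩
  let j : C(Y, E.carrier) := ⟨((↑) : Y → E.carrier), continuous_subtype_val⟩
  have hij : i ≫ TopCat.ofHom j = E.hom := rfl
  have hir : i ≫ TopCat.ofHom r = 𝟙 _ := by
    ext z
    exact congrArg _ (hr z _)
  have hbd : (singularChains Γ Y).d 2 1 b' = (chainsMap Γ i).f 1 z := by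
    apply chainsMap_injective (f := j) Subtype.val_injective
    rw [← chainsMap_d, hb', hb, ← chainsMap_comp_apply, hij]
  refine ⟨(chainsMap Γ (TopCat.ofHom r)).f 2 b', ?_⟩
  rw [chainsMap_d, hbd, ← chainsMap_comp_apply, hir, chainsMap_id_apply]

/-! ### Winding numbers and the fundamental loop -/

section Winding

/-- `u` is a continuous choice of angle for `f`, measured in full turns. -/
def IsAngle {D : Type*} [TopologicalSpace D] (f : C(D, Circle)) (u : C(D, ℝ)) : Prop :=
  ∀ x, Circle.exp (2 * Real.pi * u x) = f x

theorem exists_isAngle {n : ℕ} (f : C(stdSimplex ℝ (Fin (n + 1)), Circle)) :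
    ∃ u, IsAngle f u := by
  have := (convex_stdSimplex ℝ (Fin (n + 1))).locallyPathConnectedSpace
  have := (convex_stdSimplex ℝ (Fin (n + 1))).contractibleSpace
    ⟨_, single_mem_stdSimplex ℝ 0⟩
  obtain ⟨e, he⟩ := Circle.exp_surjective (f (stdSimplex.vertex 0))
  obtain ⟨F, ⟨-, hF⟩, -⟩ := Circle.isCoveringMap_exp.existsUnique_continuousMap_lifts f _ e he
  refine ⟨⟨fun x => F x / (2 * Real.pi), by fun_prop⟩, fun x => ?_⟩
  have := congrFun hF x
  rw [← this]
  simp only [ContinuousMap.coe_mk, Function.comp_apply]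
  congr 1
  field_simp

/-- Two angle functions of the same map differ by a constant integer, so the differences of their
integer parts agree. -/
theorem IsAngle.floor_sub_floor_eq {D : Type*} [TopologicalSpace D] [PreconnectedSpace D]
    {f : C(D, Circle)} {u v : C(D, ℝ)} (hu : IsAngle f u) (hv : IsAngle f v) (x y : D) :
    ⌊u y⌋ - ⌊u x⌋ = ⌊v y⌋ - ⌊v x⌋ := by
  have hint : ∀ z, ∃ k : ℤ, u z = v z + k := by
    intro z
    obtain ⟨k, hk⟩ := Circle.exp_eq_exp.1 ((hu z).trans (hv z).symm)
    refine ⟨k, ?_⟩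
    have := Real.pi_pos
    apply mul_left_cancel₀ (show 2 * Real.pi ≠ 0 by positivity)
    rw [hk]; ring
  choose k hk using hint
  have hkc : Continuous k := by
    rw [Int.isClosedEmbedding_coe_real.isInducing.continuous_iff]
    have : ((↑) : ℤ → ℝ) ∘ k = fun z => u z - v z := by
      ext z
      simp [hk z]
    rw [this]
    fun_prop
  have hkk : k y = k x := PreconnectedSpace.constant inferInstance hkc
  rw [hk x, hk y, hkk, Int.floor_add_intCast, Int.floor_add_intCast]
  ring

/-- The integral winding number of a singular `1`-simplex, loop or not: the increase of the
integer part of an angle function. On loops this is the usual winding number; taking integer parts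
keeps it integral on all simplices and additive over the faces of a `2`-simplex. -/
noncomputable def winding (τ : C(stdSimplex ℝ (Fin 2), Circle)) : ℤ :=
  ⌊(exists_isAngle τ).choose (stdSimplex.vertex 1)⌋ -
    ⌊(exists_isAngle τ).choose (stdSimplex.vertex 0)⌋

theorem IsAngle.winding_eq {τ : C(stdSimplex ℝ (Fin 2), Circle)} {u : C(stdSimplex ℝ (Fin 2), ℝ)}
    (hu : IsAngle τ u) :
    winding τ = ⌊u (stdSimplex.vertex 1)⌋ - ⌊u (stdSimplex.vertex 0)⌋ :=
  (exists_isAngle τ).choose_spec.floor_sub_floor_eq hu _ _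

theorem winding_fundamentalLoop : winding fundamentalLoop = 1 := by
  have h : IsAngle fundamentalLoop ⟨fun p => p.1 1,
    (continuous_apply 1).comp continuous_subtype_val⟩ := fun _ => rfl
  rw [h.winding_eq]
  simp

/-- The winding number is a cocycle: the alternating sum over the faces of a `2`-simplex vanishes,
as the angle extends over the simplex. -/
theorem sum_winding_faces (s : C(stdSimplex ℝ (Fin 3), Circle)) :
    ∑ i : Fin 3, (-1 : ℤ) ^ i.val * winding
      (s.comp ⟨stdSimplex.map i.succAbove, stdSimplex.continuous_map _⟩) = 0 := by
  obtain ⟨u, hu⟩ := exists_isAngle s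
  have h (i : Fin 3) : winding (s.comp ⟨stdSimplex.map i.succAbove, stdSimplex.continuous_map _⟩) =
      ⌊u (stdSimplex.vertex (i.succAbove 1))⌋ - ⌊u (stdSimplex.vertex (i.succAbove 0))⌋ := by
    have hi : IsAngle (s.comp ⟨stdSimplex.map i.succAbove, stdSimplex.continuous_map _⟩)
      (u.comp ⟨stdSimplex.map i.succAbove, stdSimplex.continuous_map _⟩) := fun x => hu _
    rw [hi.winding_eq]
    simp [stdSimplex.map_vertex]
  have e00 : (0 : Fin 3).succAbove (0 : Fin 2) = 1 := rfl
  have e01 : (0 : Fin 3).succAbove (1 : Fin 2) = 2 := rfl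
  have e10 : (1 : Fin 3).succAbove (0 : Fin 2) = 0 := rfl
  have e11 : (1 : Fin 3).succAbove (1 : Fin 2) = 2 := rfl
  have e20 : (2 : Fin 3).succAbove (0 : Fin 2) = 0 := rfl
  have e21 : (2 : Fin 3).succAbove (1 : Fin 2) = 1 := rfl
  simp only [h, Fin.sum_univ_three, e00, e01, e10, e11, e20, e21]
  norm_num

/-- Weighting simplices by winding numbers kills boundaries and sends `g · σ` to `g`. -/
theorem eq_zero_of_isNullHomologous_fundamentalLoop {Γ : Type} [AddCommGroup Γ] {g : Γ}
    (h : IsNullHomologous (elemChain g fundamentalLoop)) : g = 0 := by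
  obtain ⟨W, hW⟩ := exists_chain_hom (Γ := Γ) (n := 1) winding
  have hWd (b : (singularChains Γ Circle).X 2) : W ((singularChains Γ Circle).d 2 1 b) = 0 := by
    induction b using chain_induction with
    | zero => simp
    | add x y hx hy => rw [map_add, map_add, hx, hy, add_zero]
    | neg x hx => rw [map_neg, map_neg, hx, neg_zero]
    | simplex s g =>
      rw [d_simplexChain s g, map_sum]
      simp only [map_zsmul, hW, ← mul_smul]
      rw [← Finset.sum_smul]
      exact (congrArg (· • g) (sum_winding_faces s)).trans (zero_zsmul g)
  obtain ⟨b, hb⟩ := h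
  have := hWd b
  rwa [hb, elemChain_eq, hW, winding_fundamentalLoop, one_zsmul] at this

end Winding

/-! ### From chains to homology classes -/

section Homology

variable {Γ : Type u} [AddCommGroup Γ] {X : Type u} [TopologicalSpace X]

/-- Each class is represented by a `1`-chain whose image under a continuous map `f` bounds exactly
when `f` kills the class. -/
theorem exists_cycle (c : H1 Γ X) : ∃ z : (singularChains Γ X).X 1,
    ∀ {Y : Type u} [TopologicalSpace Y] (f : TopCat.of X ⟶ TopCat.of Y),
      H1map Γ f c = 0 ↔ IsNullHomologous ((chainsMap Γ f).f 1 z) := by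
  obtain ⟨y, hy⟩ := (AddCommGrpCat.epi_iff_surjective
    ((singularChains Γ X).homologyπ 1)).1 inferInstance c
  refine ⟨(singularChains Γ X).iCycles 1 y, fun {Y} _ f => ?_⟩
  have hex : (ShortComplex.mk ((singularChains Γ Y).toCycles 2 1)
      ((singularChains Γ Y).homologyπ 1) (by simp)).Exact :=
    ShortComplex.exact_of_g_is_cokernel _ ((singularChains Γ Y).homologyIsCokernel 2 1 (by simp))
  have hex' := ShortComplex.ab_exact_iff_function_exact _ |>.1 hex
  have hinj : Function.Injective ((singularChains Γ Y).iCycles 1) :=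
    (AddCommGrpCat.mono_iff_injective _).1 inferInstance
  have h1 : H1map Γ f c = (singularChains Γ Y).homologyπ 1
      (HomologicalComplex.cyclesMap (chainsMap Γ f) 1 y) := by
    rw [← hy]
    exact ConcreteCategory.congr_hom
      (HomologicalComplex.homologyπ_naturality (chainsMap Γ f) 1) y
  have h2 : (singularChains Γ Y).iCycles 1 (HomologicalComplex.cyclesMap (chainsMap Γ f) 1 y) =
      (chainsMap Γ f).f 1 ((singularChains Γ X).iCycles 1 y) :=
    ConcreteCategory.congr_hom (HomologicalComplex.cyclesMap_i (chainsMap Γ f) 1) y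
  have h3 (b : (singularChains Γ Y).X 2) : (singularChains Γ Y).iCycles 1
      ((singularChains Γ Y).toCycles 2 1 b) = (singularChains Γ Y).d 2 1 b :=
    ConcreteCategory.congr_hom ((singularChains Γ Y).toCycles_i 2 1) b
  rw [h1, ← h2]
  refine (hex' _).trans ⟨?_, ?_⟩
  · rintro ⟨b, hb⟩
    exact ⟨b, (h3 b).symm.trans (congrArg _ hb)⟩
  · rintro ⟨b, hb⟩
    exact ⟨b, hinj ((h3 b).trans hb)⟩

theorem H1map_id (c : H1 Γ X) : H1map Γ (𝟙 (TopCat.of X)) c = c := by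
  simp only [H1map, CategoryTheory.Functor.map_id]
  rfl

end Homology

/-! ### Discreteness of `d₁` and the completion -/

theorem eq_of_d₁_lt_one {Γ : Type} [AddCommGroup Γ] {a b : H1 Γ Circle} (h : d₁ a b < 1) :
    a = b := by
  simp only [d₁, iInf_lt_iff] at h
  obtain ⟨E, hE, hlt⟩ := h
  obtain ⟨z, hz⟩ := exists_cycle (a - b)
  have h0 : H1map Γ E.hom (a - b) = 0 := by rw [map_sub, hE, sub_self]
  have h1 := isNullHomologous_of_excess_lt_one E hlt ((hz _).1 h0)
  have h2 := (hz (𝟙 (TopCat.of Circle))).2 (by rwa [chainsMap_id_apply])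
  rwa [H1map_id, sub_eq_zero] at h2

/-- If distinct classes have distance at least `ε > 0`, nothing is identified in `H_d`, and `H_d` is
already complete. -/
theorem toHdHat_bijective_of_discrete {Γ : Type u} [AddCommGroup Γ] {X : Type u} [MetricSpace X]
    [CompleteSpace X] [Nonempty X] {ε : ℝ≥0∞} (hε : 0 < ε)
    (h : ∀ a b : H1 Γ X, d₁ a b < ε → a = b) : Function.Bijective (toHdHat Γ X) := by
  have hT : T0Space (H1 Γ X) := by
    refine ⟨fun a b hab => h a b ?_⟩
    rw [EMetric.inseparable_iff] at hab
    exact lt_of_eq_of_lt hab hε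
  have hC : CompleteSpace (H1 Γ X) := by
    refine EMetric.complete_of_cauchySeq_tendsto fun v hv => ?_
    obtain ⟨N, hN⟩ := EMetric.cauchySeq_iff.1 hv ε hε
    refine ⟨v N, tendsto_const_nhds.congr' ?_⟩
    filter_upwards [Filter.eventually_ge_atTop N] with n hn
    exact h _ _ (hN N le_rfl n hn)
  constructor
  · intro a b hab
    have := UniformSpace.Completion.coe_injective (Hd Γ X) hab
    exact (SeparationQuotient.mk_eq_mk.1 this).eq
  · intro x
    have hr : IsClosed (range ((↑) : Hd Γ X → HdHat Γ X)) :=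
      (UniformSpace.Completion.isUniformEmbedding_coe (Hd Γ X)).isClosedEmbedding.isClosed_range
    have hu : range ((↑) : Hd Γ X → HdHat Γ X) = univ := by
      rw [← hr.closure_eq]
      exact UniformSpace.Completion.denseRange_coe.closure_range
    obtain ⟨y, rfl⟩ := hu.symm ▸ mem_univ x
    obtain ⟨c, rfl⟩ := SeparationQuotient.surjective_mk y
    exact ⟨c, rfl⟩

theorem theorem6p1 (Γ : Type) [AddCommGroup Γ] :
    (∃ e : H1 Γ Circle ≃+ HdHat Γ Circle, ∀ c, e c = toHdHat Γ Circle c) ∧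
    (∀ g : Γ, g ≠ 0 → ∀ E : AreaExtension Circle,
      IsNullHomologous (elemChain g (E.inclC.comp fundamentalLoop)) → 1 ≤ E.excess) := by
  refine ⟨?_, fun g hg E hE => ?_⟩
  · have hb : Function.Bijective (toHdHat Γ Circle) :=
      toHdHat_bijective_of_discrete zero_lt_one fun a b => eq_of_d₁_lt_one
    refine ⟨{ Equiv.ofBijective _ hb with map_add' := fun a b => ?_ }, fun c => rfl⟩
    exact UniformSpace.Completion.coe_add (SeparationQuotient.mk a : Hd Γ Circle)
      (SeparationQuotient.mk b)
  · by_contra! hlt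
    refine hg (eq_zero_of_isNullHomologous_fundamentalLoop
      (isNullHomologous_of_excess_lt_one E hlt ?_))
    rw [elemChain_eq] at hE ⊢
    exact (chainsMap_simplexChain E.inclC fundamentalLoop g).symm ▸ hE
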